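/- For $n\ge 1$ let $Q_n$ be the $n$-dimensional hypercube: its vertex set is $V(Q_n)=\{0,1\}^n$, and two vertices are adjacent if and only if they differ in exactly one coordinate. For $S\subset V(Q_n)$ let $\theta(n,S)$ be the number of edges $\{v,w\}$ of $Q_n$ with $v\in S$ and $w\notin S$, and let $$\operatorname{Type}(S)=\min_{H}|S\cap H|,$$ where $H$ runs over the $2n$ half planes $\{x\in\{0,1\}^n : x_i=a\}$, $1\le i\le n$, $a\in\{0,1\}$. Put $$\theta(n,k,t)=\min\{\theta(n,S) : S\subset V(Q_n),\ |S|=k,\ \operatorname{Type}(S)=t\}$$ (with $\min\emptyset=+\infty$), and $f(x)=\frac34-\frac{64}{7}\left(x-\frac12\right)^2$ for real $x$. Theorem. For any integers $n,k,t$ with $n\ge 5$, $0<2t\le k\le 2^{n-1}$ and $2^{-n}t>\frac1{24}+\frac7{64}$, we have $$\theta(n,k,t)\ge 2^n f(2^{-n}k).$$ -/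

import Mathlib

namespace CircularWirelength

/-- The `n`-dimensional hypercube `Q_n`: the vertices are the binary `n`-tuples, and two of them are
adjacent iff they differ in exactly one coordinate. -/
def hypercube (n : ℕ) : SimpleGraph (Fin n → Bool) where
  Adj u v := ∃! i, u i ≠ v i
  symm := ⟨fun _ _ ⟨i, hi, h⟩ => ⟨i, fun e => hi e.symm, fun j hj => h j fun e => hj e.symm⟩⟩
  loopless := ⟨fun _ ⟨_, hi, _⟩ => hi rfl⟩

/-- `θ(n, S)`: the number of edges `{v, w}` of `Q_n` with `v ∈ S` and `w ∉ S`. -/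
noncomputable def edgeBoundary (n : ℕ) (S : Finset (Fin n → Bool)) : ℕ :=
  {e : Sym2 (Fin n → Bool) |
    e ∈ (hypercube n).edgeSet ∧ ∃ v w, e = s(v, w) ∧ v ∈ S ∧ w ∉ S}.ncard

/-- The half plane of `Q_n` of all vertices whose `i`-th coordinate equals `a`. -/
def halfPlane (n : ℕ) (i : Fin n) (a : Bool) : Finset (Fin n → Bool) :=
  Finset.univ.filter fun x => x i = a

/-- `Type(S)`: the minimum of `|S ∩ H|` over the `2n` half planes `H` of `Q_n`
(meaningful for `n ≥ 1`, where the infimum of this nonempty family in `ℕ` is attained). -/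
noncomputable def type (n : ℕ) (S : Finset (Fin n → Bool)) : ℕ :=
  ⨅ p : Fin n × Bool, (S ∩ halfPlane n p.1 p.2).card

/-- `θ(n, k, t)`: the minimum of `θ(n, S)` over the sets `S` of vertices of `Q_n` with `|S| = k` and
`Type(S) = t`; it is `⊤` if there is no such set. -/
noncomputable def theta (n k t : ℕ) : ℕ∞ :=
  ⨅ S : {S : Finset (Fin n → Bool) // S.card = k ∧ type n S = t}, (edgeBoundary n S.1 : ℕ∞)

/-- `f(x) = 3/4 - (64/7) (x - 1/2)^2`. -/
noncomputable def f (x : ℝ) : ℝ := 3 / 4 - 64 / 7 * (x - 1 / 2) ^ 2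

end CircularWirelength

/-! Let `g` be the indicator of `S`, `p` its mean and `c` a degree one Walsh coefficient;
`θ(n,S)/2^n` is the total influence `E`. Weight above degree one counts at least twice in `E`, so
`4p(1-p) ≤ E + 2∑c²`, and `|c|` is at most the influence in its direction. Hence `|c| ≤ M`
throughout gives `4p(1-p) ≤ (1+2M)E`. A large type forces `|c| ≤ p - 7/24`. If also every `|c| ≤ 5/8
- p`, then `M = 1/6` gives `E ≥ 3p(1-p) ≥ f(p)`. Otherwise, splitting along a large `c` and bounding
both halves by `energy_ge_quarter_add` gives `E ≥ 3/4`. -/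

namespace CircularWirelength

open Finset

/-! ### Fourier analysis on the cube. -/

section Cube

variable {n : ℕ}

/-- The average of a function on the cube. -/
noncomputable def mean (g : (Fin n → Bool) → ℝ) : ℝ := (∑ x, g x) / 2 ^ n

/-- The vertex of the cube obtained from `x` by changing its `i`-th coordinate. -/
def flip (x : Fin n → Bool) (i : Fin n) : Fin n → Bool := Function.update x i (!x i)

/-- The degree one Fourier coefficient of `g` in direction `i`. -/
noncomputable def coeff (g : (Fin n → Bool) → ℝ) (i : Fin n) : ℝ :=
  mean fun x => (if x i then 1 else -1) * g x

/-- The influence of the `i`-th coordinate on `g`, normalized so that for an indicator function it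
is the number of boundary edges in direction `i`, divided by `2 ^ n`. -/
noncomputable def influence (g : (Fin n → Bool) → ℝ) (i : Fin n) : ℝ :=
  mean (fun x => (g x - g (flip x i)) ^ 2) / 2

/-- The total influence of `g`. -/
noncomputable def energy (g : (Fin n → Bool) → ℝ) : ℝ := ∑ i, influence g i

/-- The restriction of `g` to the half cube on which the `i`-th coordinate is `b`. -/
def slice (g : (Fin (n + 1) → Bool) → ℝ) (i : Fin (n + 1)) (b : Bool) : (Fin n → Bool) → ℝ :=
  fun y => g (i.insertNth b y)

lemma slice_def (g : (Fin (n + 1) → Bool) → ℝ) (i : Fin (n + 1)) (b : Bool) :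
    slice g i b = fun y => g (i.insertNth b y) := rfl

lemma flip_insertNth_same (i : Fin (n + 1)) (b : Bool) (y : Fin n → Bool) :
    flip (i.insertNth b y) i = i.insertNth (!b) y := by
  simp [flip]

lemma flip_insertNth_succAbove (i : Fin (n + 1)) (j : Fin n) (b : Bool) (y : Fin n → Bool) :
    flip (i.insertNth b y) (i.succAbove j) = i.insertNth b (flip y j) := by
  simp [flip, Fin.insertNth_update]

lemma mean_add (g h : (Fin n → Bool) → ℝ) : mean (fun x => g x + h x) = mean g + mean h := by
  simp [mean, sum_add_distrib, add_div]

lemma mean_sub (g h : (Fin n → Bool) → ℝ) : mean (fun x => g x - h x) = mean g - mean h := by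
  simp [mean, sub_div]

lemma mean_mono {g h : (Fin n → Bool) → ℝ} (hgh : ∀ x, g x ≤ h x) : mean g ≤ mean h := by
  unfold mean
  gcongr
  exact hgh _

lemma mean_const (c : ℝ) : mean (fun _ : Fin n → Bool => c) = c := by
  simp [mean]

lemma mean_slice (g : (Fin (n + 1) → Bool) → ℝ) (i : Fin (n + 1)) :
    mean g = (mean (slice g i false) + mean (slice g i true)) / 2 := by
  have h : ∑ x, g x = ∑ y, slice g i true y + ∑ y, slice g i false y := by
    rw [← (Fin.insertNthEquiv (fun _ => Bool) i).sum_comp, Fintype.sum_prod_type]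
    simp [slice, Fin.insertNthEquiv]
  simp only [mean, h, pow_succ]
  field_simp
  ring

lemma coeff_sub (g h : (Fin n → Bool) → ℝ) (i : Fin n) :
    coeff (fun x => g x - h x) i = coeff g i - coeff h i := by
  simp only [coeff, mul_sub, mean_sub]

lemma coeff_same (g : (Fin (n + 1) → Bool) → ℝ) (i : Fin (n + 1)) :
    coeff g i = (mean (slice g i true) - mean (slice g i false)) / 2 := by
  have h := mean_sub (fun _ => 0) (slice g i false)
  simp only [mean_const, zero_sub] at h
  rw [coeff, mean_slice _ i]
  simp only [slice_def, Fin.insertNth_apply_same] at h ⊢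
  simp only [Bool.false_eq_true, if_false, if_true, neg_mul, one_mul, h]
  ring

lemma coeff_succAbove (g : (Fin (n + 1) → Bool) → ℝ) (i : Fin (n + 1)) (j : Fin n) :
    coeff g (i.succAbove j) = (coeff (slice g i false) j + coeff (slice g i true) j) / 2 := by
  rw [coeff, mean_slice _ i]
  simp only [slice_def, Fin.insertNth_apply_succAbove, coeff]

lemma influence_same (g : (Fin (n + 1) → Bool) → ℝ) (i : Fin (n + 1)) :
    influence g i = mean (fun y => (slice g i false y - slice g i true y) ^ 2) / 2 := by
  rw [influence, mean_slice _ i]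
  simp only [slice_def, flip_insertNth_same, Bool.not_false, Bool.not_true]
  simp only [sub_sq_comm (g (i.insertNth true _))]
  ring

lemma influence_succAbove (g : (Fin (n + 1) → Bool) → ℝ) (i : Fin (n + 1)) (j : Fin n) :
    influence g (i.succAbove j) =
      (influence (slice g i false) j + influence (slice g i true) j) / 2 := by
  rw [influence, mean_slice _ i]
  simp only [slice_def, flip_insertNth_succAbove, influence]
  ring

lemma energy_slice (g : (Fin (n + 1) → Bool) → ℝ) (i : Fin (n + 1)) :
    energy g = influence g i + (energy (slice g i false) + energy (slice g i true)) / 2 := by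
  simp only [energy]
  rw [Fin.sum_univ_succAbove _ i]
  simp only [influence_succAbove, ← sum_div, sum_add_distrib]

/-- Bessel's inequality for the Fourier coefficients of degree at most one. -/
lemma bessel (g : (Fin n → Bool) → ℝ) :
    mean g ^ 2 + ∑ i, coeff g i ^ 2 ≤ mean fun x => g x ^ 2 := by
  induction n with
  | zero => simp [mean]
  | succ n ih =>
    have h0 := ih (slice g 0 false)
    have h1 := ih (slice g 0 true)
    have hs : 2 * ∑ j, ((coeff (slice g 0 false) j + coeff (slice g 0 true) j) / 2) ^ 2 ≤
        ∑ j, coeff (slice g 0 false) j ^ 2 + ∑ j, coeff (slice g 0 true) j ^ 2 := by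
      rw [← sum_add_distrib, mul_sum]
      refine sum_le_sum fun j _ => ?_
      nlinarith [sq_nonneg (coeff (slice g 0 false) j - coeff (slice g 0 true) j)]
    have hq := mean_slice (fun x => g x ^ 2) 0
    rw [Fin.sum_univ_succAbove _ 0, mean_slice g 0, coeff_same, hq]
    simp only [coeff_succAbove]
    simp only [slice_def] at h0 h1 hs ⊢
    linarith

/-- The Poincaré inequality, sharpened to the weight above degree one. -/
lemma energy_ge (g : (Fin n → Bool) → ℝ) :
    4 * ((mean fun x => g x ^ 2) - mean g ^ 2) - 2 * ∑ i, coeff g i ^ 2 ≤ energy g := by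
  induction n with
  | zero => simp [mean, energy]
  | succ n ih =>
    have h0 := ih (slice g 0 false)
    have h1 := ih (slice g 0 true)
    -- The influence in direction 0 is half the mean square of this difference, whose degree one
    -- coefficients carry the degree two weight of `g` on the pairs `{0, j}`.
    have hb := bessel fun y => slice g 0 false y - slice g 0 true y
    simp only [mean_sub, coeff_sub] at hb
    have hs : 4 * ∑ j, ((coeff (slice g 0 false) j + coeff (slice g 0 true) j) / 2) ^ 2 +
        ∑ j, (coeff (slice g 0 false) j - coeff (slice g 0 true) j) ^ 2 =
        2 * ∑ j, coeff (slice g 0 false) j ^ 2 + 2 * ∑ j, coeff (slice g 0 true) j ^ 2 := by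
      simp only [mul_sum, ← sum_add_distrib]
      refine sum_congr rfl fun j _ => ?_
      ring
    have hq := mean_slice (fun x => g x ^ 2) 0
    rw [energy_slice g 0, influence_same, Fin.sum_univ_succAbove _ 0, mean_slice g 0, coeff_same,
      hq]
    simp only [coeff_succAbove]
    simp only [slice_def] at h0 h1 hs hb ⊢
    linarith

/-! ### Isoperimetric bounds for indicator functions. -/

/-- `g` is the indicator function of some set of vertices. -/
def IsIndicator (g : (Fin n → Bool) → ℝ) : Prop := ∀ x, g x = 0 ∨ g x = 1

namespace IsIndicator

lemma slice {g : (Fin (n + 1) → Bool) → ℝ} (hg : IsIndicator g) (i : Fin (n + 1)) (b : Bool) :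
    IsIndicator (slice g i b) := fun _ => hg _

lemma compl {g : (Fin n → Bool) → ℝ} (hg : IsIndicator g) : IsIndicator fun x => 1 - g x := by
  intro x
  rcases hg x with h | h <;> simp [h]

lemma mean_nonneg {g : (Fin n → Bool) → ℝ} (hg : IsIndicator g) : 0 ≤ mean g := by
  rw [← mean_const (n := n) 0]
  refine mean_mono fun x => ?_
  rcases hg x with h | h <;> simp [h]

lemma mean_sq {g : (Fin n → Bool) → ℝ} (hg : IsIndicator g) :
    (mean fun x => g x ^ 2) = mean g := by
  congr 1
  funext x
  rcases hg x with h | h <;> simp [h]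

/-- The slice difference takes values in `{-1, 0, 1}`, so its square dominates it and its negative
pointwise. -/
lemma abs_coeff_le_influence {g : (Fin n → Bool) → ℝ} (hg : IsIndicator g) (i : Fin n) :
    |coeff g i| ≤ influence g i := by
  obtain _ | n := n
  · exact i.elim0
  rw [coeff_same, influence_same, abs_div, abs_two]
  gcongr
  rw [← mean_sub, abs_le, ← sub_nonneg, sub_neg_eq_add, ← mean_add, ← mean_const (n := n) 0]
  constructor <;> refine mean_mono fun y => ?_ <;>
    rcases hg.slice i false y with h | h <;> rcases hg.slice i true y with h' | h' <;>
    norm_num [h, h']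

lemma abs_coeff_le_mean {g : (Fin n → Bool) → ℝ} (hg : IsIndicator g) (i : Fin n) :
    |coeff g i| ≤ mean g := by
  obtain _ | n := n
  · exact i.elim0
  rw [coeff_same, mean_slice g i, abs_le]
  have h0 := (hg.slice i false).mean_nonneg
  have h1 := (hg.slice i true).mean_nonneg
  constructor <;> linarith

end IsIndicator

lemma mean_compl (g : (Fin n → Bool) → ℝ) : mean (fun x => 1 - g x) = 1 - mean g := by
  rw [mean_sub, mean_const]

lemma energy_compl (g : (Fin n → Bool) → ℝ) : energy (fun x => 1 - g x) = energy g := by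
  simp only [energy, influence, sub_sub_sub_cancel_left]
  simp only [sub_sq_comm (g (flip _ _))]

namespace IsIndicator

/-- A set all of whose degree one Fourier coefficients are small has many boundary edges. -/
lemma mul_energy_ge {g : (Fin n → Bool) → ℝ} (hg : IsIndicator g) {M : ℝ} (hM : 0 ≤ M)
    (h : ∀ i, |coeff g i| ≤ M) : 4 * (mean g * (1 - mean g)) ≤ energy g * (1 + 2 * M) := by
  have h1 := energy_ge g
  rw [hg.mean_sq] at h1
  have h2 : ∑ i, coeff g i ^ 2 ≤ M * energy g := by
    rw [energy, mul_sum]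
    refine sum_le_sum fun i _ => ?_
    rw [← sq_abs, sq]
    exact mul_le_mul (h i) (hg.abs_coeff_le_influence i) (abs_nonneg _) hM
  linarith

lemma mul_energy_ge_mean {g : (Fin n → Bool) → ℝ} (hg : IsIndicator g) :
    4 * (mean g * (1 - mean g)) ≤ energy g * (1 + 2 * mean g) :=
  hg.mul_energy_ge hg.mean_nonneg hg.abs_coeff_le_mean

/-- Splitting along direction `i` gives two sets whose densities differ from that of the original
one by the degree one Fourier coefficient in this direction. -/
lemma exists_split {g : (Fin n → Bool) → ℝ} (hg : IsIndicator g) (i : Fin n) :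
    ∃ (m : ℕ) (g₀ g₁ : (Fin m → Bool) → ℝ), IsIndicator g₀ ∧ IsIndicator g₁ ∧
      mean g₀ = mean g - |coeff g i| ∧ mean g₁ = mean g + |coeff g i| ∧
      |coeff g i| + (energy g₀ + energy g₁) / 2 ≤ energy g := by
  obtain _ | n := n
  · exact i.elim0
  have hm := mean_slice g i
  have hc := coeff_same g i
  have he := energy_slice g i
  have hi := hg.abs_coeff_le_influence i
  rcases abs_cases (coeff g i) with ⟨h, -⟩ | ⟨h, -⟩
  · exact ⟨n, CircularWirelength.slice g i false, CircularWirelength.slice g i true,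
      hg.slice i false, hg.slice i true, by linarith, by linarith, by linarith⟩
  · exact ⟨n, CircularWirelength.slice g i true, CircularWirelength.slice g i false,
      hg.slice i true, hg.slice i false, by linarith, by linarith, by linarith⟩

/-- A sharp edge-isoperimetric inequality for sets of density between `1/4` and `3/8`. -/
lemma energy_ge_quarter_add {g : (Fin n → Bool) → ℝ} (hg : IsIndicator g)
    (hl : 1 / 4 ≤ mean g) (hu : mean g ≤ 3 / 8) : 1 / 4 + mean g ≤ energy g := by
  -- This threshold makes `1 + 2M = 2(1 - p)`, which cancels to `E ≥ 2p`. Beyond it, the light half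
  -- has density at most `1/4` and the heavy one lies in `[1/2, 3/4]`.
  by_cases h : ∀ i, |coeff g i| ≤ 1 / 2 - mean g
  · have hE := hg.mul_energy_ge (by linarith) h
    have : 0 < 1 - mean g := by linarith
    have : 2 * mean g ≤ energy g := by nlinarith
    linarith
  · push Not at h
    obtain ⟨i, hi⟩ := h
    have hi' := hg.abs_coeff_le_mean i
    obtain ⟨m, g₀, g₁, hg₀, hg₁, hm₀, hm₁, hE⟩ := hg.exists_split i
    have h₀ : 2 * mean g₀ ≤ energy g₀ := by
      have h := hg₀.mul_energy_ge_mean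
      have hp := hg₀.mean_nonneg
      have hq : mean g₀ ≤ 1 / 4 := by linarith
      nlinarith
    have h₁ : 1 / 2 ≤ energy g₁ := by
      have h := hg₁.compl.mul_energy_ge_mean
      rw [energy_compl, mean_compl] at h
      have hp : 1 / 2 ≤ mean g₁ := by linarith
      have hq : mean g₁ ≤ 3 / 4 := by linarith
      -- With `q = 1 - mean g₁`, this is `(4q - 1)(2q - 1) ≤ 0`.
      nlinarith
    linarith

/-- Sets of density `p ≤ 1/2` with small degree one Fourier coefficients satisfy the bound `f`. -/
lemma energy_ge_f {g : (Fin n → Bool) → ℝ} (hg : IsIndicator g) (hp : mean g ≤ 1 / 2)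
    (h : ∀ i, |coeff g i| ≤ mean g - 7 / 24) : f (mean g) ≤ energy g := by
  unfold f
  have hs := sq_nonneg (mean g - 1 / 2)
  by_cases hM : ∀ i, |coeff g i| ≤ 5 / 8 - mean g
  · have hE := hg.mul_energy_ge (M := 1 / 6) (by norm_num) fun i => by linarith [h i, hM i]
    nlinarith
  · push Not at hM
    obtain ⟨i, hi⟩ := hM
    have hi' := h i
    obtain ⟨m, g₀, g₁, hg₀, hg₁, hm₀, hm₁, hE⟩ := hg.exists_split i
    -- The light half and the complement of the heavy one have densities in `[1/4, 3/8]`. The two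
    -- bounds average to `3/4 - |c|`, and the split adds `|c|` back.
    have h₀ := hg₀.energy_ge_quarter_add (by linarith) (by linarith)
    have h₁ := hg₁.compl.energy_ge_quarter_add (by rw [mean_compl]; linarith)
      (by rw [mean_compl]; linarith)
    rw [energy_compl, mean_compl] at h₁
    linarith

end IsIndicator

end Cube

/-! ### Translation to edge counts and type. -/

section Boundary

variable {n : ℕ}

/-- The indicator function of a set of vertices. -/
noncomputable def indicator (S : Finset (Fin n → Bool)) : (Fin n → Bool) → ℝ :=
  fun x => if x ∈ S then 1 else 0

lemma isIndicator_indicator (S : Finset (Fin n → Bool)) : IsIndicator (indicator S) := by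
  intro x
  by_cases h : x ∈ S <;> simp [indicator, h]

lemma mean_indicator (S : Finset (Fin n → Bool)) : mean (indicator S) = S.card / 2 ^ n := by
  simp [mean, indicator]

lemma flip_flip (x : Fin n → Bool) (i : Fin n) : flip (flip x i) i = x := by
  simp [flip]

lemma flip_ne (x : Fin n → Bool) (i j : Fin n) : flip x i j ≠ x j ↔ j = i := by
  by_cases h : j = i
  · subst h
    simp [flip]
  · simp [flip, h]

lemma flip_injective (x : Fin n → Bool) : Function.Injective (flip x) := by
  intro i j h
  rw [← flip_ne x j i, ← h, flip_ne]

lemma adj_flip (x : Fin n → Bool) (i : Fin n) : (hypercube n).Adj x (flip x i) :=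
  ⟨i, ((flip_ne x i i).2 rfl).symm, fun j hj => (flip_ne x i j).1 hj.symm⟩

/-- Each boundary edge is seen from both endpoints, which cancels the `1/2` in `influence`. -/
lemma influence_indicator (S : Finset (Fin n → Bool)) (i : Fin n) :
    influence (indicator S) i = (univ.filter fun x => x ∈ S ∧ flip x i ∉ S).card / 2 ^ n := by
  have hswap : ∑ x, (if flip x i ∈ S ∧ x ∉ S then (1 : ℝ) else 0) =
      ∑ x, if x ∈ S ∧ flip x i ∉ S then (1 : ℝ) else 0 := by
    refine Fintype.sum_equiv ⟨fun x => flip x i, fun x => flip x i, fun x => flip_flip x i,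
      fun x => flip_flip x i⟩ _ _ fun x => ?_
    simp [flip_flip]
  have hsum : ∑ x, (indicator S x - indicator S (flip x i)) ^ 2 =
      2 * ∑ x, if x ∈ S ∧ flip x i ∉ S then (1 : ℝ) else 0 := by
    rw [two_mul]
    nth_rewrite 2 [← hswap]
    rw [← sum_add_distrib]
    refine sum_congr rfl fun x _ => ?_
    by_cases h : x ∈ S <;> by_cases h' : flip x i ∈ S <;> simp [indicator, h, h']
  rw [influence, mean, hsum, sum_boole]
  ring

lemma energy_indicator_le (S : Finset (Fin n → Bool)) :
    2 ^ n * energy (indicator S) ≤ edgeBoundary n S := by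
  have hE : 2 ^ n * energy (indicator S) =
      ((univ.sigma fun i => univ.filter fun x => x ∈ S ∧ flip x i ∉ S).card : ℝ) := by
    simp only [energy, influence_indicator, card_sigma, ← sum_div]
    push_cast
    field_simp
  rw [hE, Nat.cast_le, ← Set.ncard_coe_finset, edgeBoundary]
  refine Set.ncard_le_ncard_of_injOn (fun p => s(p.2, flip p.2 p.1)) ?_ ?_ (Set.toFinite _)
  · rintro ⟨i, x⟩ hx
    simp only [coe_sigma, Set.mem_sigma_iff, mem_coe, mem_filter, mem_univ, true_and] at hx
    exact ⟨adj_flip x i, x, flip x i, rfl, hx⟩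
  · rintro ⟨i, x⟩ hx ⟨j, y⟩ hy hxy
    simp only [coe_sigma, Set.mem_sigma_iff, mem_coe, mem_filter, mem_univ, true_and] at hx hy
    rcases Sym2.eq_iff.1 hxy with ⟨h1, h2⟩ | ⟨h1, -⟩
    · dsimp only at h1 h2
      subst h1
      rw [flip_injective x h2]
    · exact absurd (h1 ▸ hx.1) hy.2

lemma type_le (S : Finset (Fin n → Bool)) (i : Fin n) (a : Bool) :
    type n S ≤ (S ∩ halfPlane n i a).card :=
  ciInf_le (OrderBot.bddBelow _) ((i, a) : Fin n × Bool)

lemma coeff_indicator (S : Finset (Fin n → Bool)) (i : Fin n) :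
    coeff (indicator S) i =
      ((S ∩ halfPlane n i true).card - (S ∩ halfPlane n i false).card) / 2 ^ n := by
  have h (a : Bool) : ((S ∩ halfPlane n i a).card : ℝ) =
      ∑ x, if x ∈ S ∧ x i = a then 1 else 0 := by
    rw [sum_boole]
    congr 2
    ext x
    simp [halfPlane]
  rw [coeff, mean, h, h, ← sum_sub_distrib]
  congr 1
  refine sum_congr rfl fun x _ => ?_
  by_cases hx : x ∈ S <;> cases hi : x i <;> simp [indicator, hx]

lemma card_inter_halfPlane_add (S : Finset (Fin n → Bool)) (i : Fin n) :
    (S ∩ halfPlane n i true).card + (S ∩ halfPlane n i false).card = S.card := by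
  rw [← card_filter_add_card_filter_not (s := S) (fun x => x i = true)]
  congr 2 <;> ext x <;> simp [halfPlane]

lemma abs_coeff_indicator_le (S : Finset (Fin n → Bool)) (i : Fin n) :
    |coeff (indicator S) i| ≤ (S.card - 2 * type n S) / 2 ^ n := by
  have h1 : (type n S : ℝ) ≤ (S ∩ halfPlane n i true).card := by exact_mod_cast type_le S i true
  have h2 : (type n S : ℝ) ≤ (S ∩ halfPlane n i false).card := by exact_mod_cast type_le S i false
  have h3 : ((S ∩ halfPlane n i true).card : ℝ) + (S ∩ halfPlane n i false).card = S.card := by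
    exact_mod_cast card_inter_halfPlane_add S i
  rw [coeff_indicator, abs_div, abs_of_pos (by positivity : (0 : ℝ) < 2 ^ n)]
  gcongr
  rw [abs_le]
  constructor <;> linarith

lemma f_le_edgeBoundary (S : Finset (Fin n → Bool)) (hS : 2 * S.card ≤ 2 ^ n)
    (ht : (7 / 48 : ℝ) ≤ type n S / 2 ^ n) :
    2 ^ n * f (S.card / 2 ^ n) ≤ edgeBoundary n S := by
  have hpos : (0 : ℝ) < 2 ^ n := by positivity
  have hS' : (2 : ℝ) * S.card ≤ 2 ^ n := by exact_mod_cast hS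
  refine le_trans ?_ (energy_indicator_le S)
  gcongr
  rw [← mean_indicator]
  refine (isIndicator_indicator S).energy_ge_f ?_ fun i => ?_
  · rw [mean_indicator, div_le_iff₀ hpos]
    linarith
  · refine (abs_coeff_indicator_le S i).trans ?_
    rw [mean_indicator, sub_div, mul_div_assoc]
    linarith

end Boundary

end CircularWirelength

theorem theorem3 (n k t : ℕ) (hn : 5 ≤ n) (ht : 0 < 2 * t) (htk : 2 * t ≤ k)
    (hk : k ≤ 2 ^ (n - 1))
    (hlarge : (2 : ℝ) ^ (-(n : ℤ)) * (t : ℝ) > 1 / 24 + 7 / 64) :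
    (((2 : ℝ) ^ n * CircularWirelength.f ((2 : ℝ) ^ (-(n : ℤ)) * (k : ℝ)) : ℝ) : EReal) ≤
      (((CircularWirelength.theta n k t : ℕ∞) : ENNReal) : EReal) := by
  rcases isEmpty_or_nonempty {S : Finset (Fin n → Bool) // S.card = k ∧ CircularWirelength.type n S = t}
    with hS | hS
  -- With no admissible set the infimum is `⊤`.
  · simp [CircularWirelength.theta]
  · obtain ⟨⟨S, rfl, rfl⟩, hθ⟩ := ENat.exists_eq_iInf
      fun S : {S : Finset (Fin n → Bool) // S.card = k ∧ CircularWirelength.type n S = t} =>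
        (CircularWirelength.edgeBoundary n S.1 : ℕ∞)
    have hk' : 2 * S.card ≤ 2 ^ n := by
      obtain _ | n := n
      · omega
      · rw [pow_succ']
        simpa using hk
    rw [zpow_neg, zpow_natCast, inv_mul_eq_div] at hlarge
    -- The assumed `29/192` exceeds the required `7/48 = 28/192`.
    have h := CircularWirelength.f_le_edgeBoundary S hk' (by linarith)
    rw [CircularWirelength.theta, ← hθ, zpow_neg, zpow_natCast, inv_mul_eq_div]
    rw [ENat.toENNReal_coe, ← ENNReal.ofReal_natCast, EReal.coe_ennreal_ofReal,
      max_eq_left (Nat.cast_nonneg _)]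
    exact EReal.coe_le_coe_iff.2 h
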